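/- Let $\Delta=\{\mathbf{e},\mathbf{n},\mathbf{w},\mathbf{s}\}=\{e_1,e_2,-e_1,-e_2\}$ be the set of unit vectors of $\mathbb{Z}^2$. An environment is a family $\omega=\{\omega_x\}_{x\in\mathbb{Z}^2}$ of stochastic matrices indexed by $\Delta$. The persistent random walk in $\omega$ with initial condition $\xi=(x_0,d_0)\in\mathbb{Z}^2\times\Delta$ is the Markov chain $(X_n,D_n)_{n\ge 0}$ on $\mathbb{Z}^2\times\Delta$, with law $P_\xi^\omega$, which starts at $\xi$ and jumps from $(x,d)$ to $(x+d',d')$ with probability $\omega_x(d,d')$ for each $d'\in\Delta$. It is called recurrent if for every initial condition $\xi\in\mathbb{Z}^2\times\Delta$, $$P_\xi^\omega\{(X_n,D_n)=\xi=(X_0,D_0)\text{ for some } n>0\}=1 .$$ For $d\in\Delta$ write $\mathbf{f}(d)=d$ (Forward), $\mathbf{b}(d)=-d$ (Backward), $\mathbf{l}(d)=d^\perp$ (Left) and $\mathbf{r}(d)=-d^\perp$ (Right), where $d^\perp$ is $d$ rotated counterclockwise by a right angle. A site $x=(x^1,x^2)$ is called even or odd according to the parity of $x^1+x^2$. Let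 $\{\zeta_x\}_{x\in\mathbb{Z}^2}$ be numbers in $[0,1]$ with $\zeta_x<1$ for all but finitely many $x$. Define the environment $\omega$ as follows: if $x$ is even and $d=\mathbf{n}$ (arrival from the South), or $x$ is odd and $d=\mathbf{s}$ (arrival from the North), then $$\omega_x(d,\mathbf{f}(d))=\zeta_x,\qquad \omega_x(d,\mathbf{l}(d))=\omega_x(d,\mathbf{r}(d))=\frac{1-\zeta_x}{2},\qquad \omega_x(d,\mathbf{b}(d))=0;$$ for all other pairs $(x,d)$, $$\omega_x(d,\mathbf{f}(d))=0,\qquad \omega_x(d,\mathbf{l}(d))=\omega_x(d,\mathbf{r}(d))=\frac12,\qquad \omega_x(d,\mathbf{b}(d))=0.$$ If $\zeta_x>0$ for at least one even site $x$ and $\zeta_y>0$ for at least one odd site $y$, then the persistent random walk in $\omega$ is recurrent. (No balance condition on the local drift $\sum_{d'}\omega_x(d,d')\,d'$ is assumed.) -/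

import Mathlib

open MeasureTheory ProbabilityTheory
open scoped ENNReal

namespace PRW

/-- The four absolute directions of `ℤ²`: East, North, West, South. -/
inductive Dir where
  | e
  | n
  | w
  | s
  deriving DecidableEq

namespace Dir

instance : Fintype Dir := ⟨{e, n, w, s}, fun d => by cases d <;> simp⟩

/-- The lattice vector of a direction: `e₁, e₂, -e₁, -e₂`. -/
def vec : Dir → ℤ × ℤ
  | e => (1, 0)
  | n => (0, 1)
  | w => (-1, 0)
  | s => (0, -1)

/-- The direction Left of `d`, i.e. `d` rotated by a right angle counterclockwise. -/
def left : Dir → Dir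
  | e => n
  | n => w
  | w => s
  | s => e

/-- The direction Right of `d`. -/
def right : Dir → Dir
  | e => s
  | n => e
  | w => n
  | s => w

/-- The direction Forward of `d`. -/
def forward (d : Dir) : Dir := d

/-- The direction Backward of `d`. -/
def backward : Dir → Dir
  | e => w
  | n => s
  | w => e
  | s => n

instance : MeasurableSpace Dir := ⊤

instance : DiscreteMeasurableSpace Dir := ⟨fun _ => trivial⟩

end Dir

/-- A state `(x, d)` of a persistent walk: current position and direction of the last jump. -/
abbrev State : Type := (ℤ × ℤ) × Dir

/-- An environment: a stochastic matrix indexed by directions at every site. -/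
abbrev Env : Type := ℤ × ℤ → Matrix.rowStochastic ℝ Dir

/-- The transition law of the walk from `(x, d)`: the walk moves to `(x + d', d')` with
probability `ω_x(d, d')`. -/
noncomputable def stepMeasure (ω : Env) (z : State) : Measure State :=
  ∑ d' : Dir, ENNReal.ofReal ((ω z.1 : Matrix Dir Dir ℝ) z.2 d') •
    Measure.dirac (z.1 + d'.vec, d')

/-- The one-step transition kernel of the walk. -/
noncomputable def stepKernel (ω : Env) : Kernel State State :=
  Kernel.ofFunOfCountable (stepMeasure ω)

instance (ω : Env) : IsMarkovKernel (stepKernel ω) := by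
  refine ⟨fun z => ⟨?_⟩⟩
  change stepMeasure ω z Set.univ = 1
  have h := Matrix.mem_rowStochastic_iff_sum.1 (ω z.1).2
  simp only [stepMeasure, Measure.finsetSum_apply, Measure.smul_apply, measure_univ,
    smul_eq_mul, mul_one]
  rw [← ENNReal.ofReal_sum_of_nonneg (fun d' _ => h.1 z.2 d'), h.2 z.2, ENNReal.ofReal_one]

/-- The transition kernel at time `k`, as a kernel from the history up to time `k`, of which it
uses only the last state. -/
noncomputable def historyKernel (ω : Env) (k : ℕ) :
    Kernel (∀ _ : Finset.Iic k, State) State :=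
  (stepKernel ω).comap (fun h => h ⟨k, Finset.mem_Iic.2 le_rfl⟩) (measurable_pi_apply _)

instance (ω : Env) (k : ℕ) : IsMarkovKernel (historyKernel ω k) := by
  unfold historyKernel; infer_instance

/-- The law `P_ξ^ω`, on the space of trajectories, of the Markov chain `(X_k, D_k)` started
at `ξ`. -/
noncomputable def law (ω : Env) (ξ : State) : Measure (ℕ → State) :=
  Kernel.traj (X := fun _ => State) (historyKernel ω) 0 (fun _ => ξ)

/-- The walk in the environment `ω` is recurrent: from every initial condition `ξ`, position and
direction return simultaneously to their initial values almost surely. -/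
def Recurrent (ω : Env) : Prop :=
  ∀ ξ : State, law ω ξ {Z | ∃ k > 0, Z k = ξ ∧ ξ = Z 0} = 1

/-- The sites with even coordinate sum. -/
def evenSites : Set (ℤ × ℤ) := {x | Even (x.1 + x.2)}

/-- The sites with odd coordinate sum. -/
def oddSites : Set (ℤ × ℤ) := evenSitesᶜ

/-- The symmetric Left-Right turning rule with Forward probability `p`: from direction `d`
Forward has probability `p`, Left and Right have probability `(1 - p) / 2` each, and Backward
has probability `0`. -/
noncomputable def turn (p : ℝ) (d d' : Dir) : ℝ :=
  if d' = d.forward then p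
  else if d' = d.left ∨ d' = d.right then (1 - p) / 2
  else 0

open Classical in
/-- The Forward probability at site `x` for incoming direction `d`: it is `ζ x` when an even site
is reached heading North, or an odd site heading South, and `0` otherwise. -/
noncomputable def forwardProb (ζ : ℤ × ℤ → unitInterval) (x : ℤ × ℤ) (d : Dir) : unitInterval :=
  if (x ∈ evenSites ∧ d = Dir.n) ∨ (x ∈ oddSites ∧ d = Dir.s) then ζ x else 0

/-- The Left-Right environment with inhomogeneous Forward probabilities `ζ`. -/
noncomputable def forwardEnv (ζ : ℤ × ℤ → unitInterval) : Env := fun x =>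
  ⟨Matrix.of fun d d' => turn (forwardProb ζ x d) d d', by
    refine Matrix.mem_rowStochastic_iff_sum.2 ⟨fun d d' => ?_, fun d => ?_⟩
    · have h0 := (forwardProb ζ x d).2.1
      have h1 := (forwardProb ζ x d).2.2
      simp only [Matrix.of_apply, turn]
      split_ifs <;> linarith
    · have hu : (Finset.univ : Finset Dir) = {Dir.e, Dir.n, Dir.w, Dir.s} := rfl
      simp only [Matrix.of_apply, hu]
      cases d <;> simp [turn, Dir.forward, Dir.left, Dir.right] <;> ring⟩

end PRW

open MeasureTheory ProbabilityTheory
open scoped ENNReal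

namespace PRW

/-! A walk heading horizontally must turn north or south, with equal probability. A walk heading
vertically either turns east or west, with equal probability, or goes forward once; after a forward
step the parity of the site forbids a second one. Raise the height by one at odd sites for
horizontal and at even sites for vertical directions. A forward step then leaves the corrected
position unchanged, so the walk seen when its direction is horizontal is, in corrected coordinates,
the simple diagonal random walk on the plane, whatever `ζ` is.

Hence a logarithm that is superharmonic for that walk far from the origin gives a Lyapunov function
(`logPotential_superharmonic`, `stepMean_lyapunov_le`). By the maximum principle, such a function
together with irreducibility forces recurrence (`recurrent_of_lyapunov`).

Irreducibility (`irreducible_forwardEnv`) is where the hypotheses on `ζ` enter. Without forward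
steps the parity of the sites visited horizontally never changes; a forward step at an odd site
leads from the even class to the odd one, and one at an even site leads back. Finiteness of `{ζ =
1}` lets the walk circle around the sites where turning may be impossible. -/

/-- The mean of `g` after one step of the walk from `z`. -/
noncomputable def stepMean (ω : Env) (g : State → ℝ) (z : State) : ℝ :=
  ∑ d' : Dir, (ω z.1 : Matrix Dir Dir ℝ) z.2 d' * g (z.1 + d'.vec, d')

/-- Sets of states which the walk cannot leave. -/
def Closed (ω : Env) (S : Set State) : Prop :=
  ∀ z ∈ S, ∀ d' : Dir, 0 < (ω z.1 : Matrix Dir Dir ℝ) z.2 d' → (z.1 + d'.vec, d') ∈ S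

/-- The walk can go from every state to every other one. -/
def Irreducible (ω : Env) : Prop :=
  ∀ S : Set State, S.Nonempty → Closed ω S → S = Set.univ

lemma env_nonneg (ω : Env) (x : ℤ × ℤ) (d d' : Dir) : 0 ≤ (ω x : Matrix Dir Dir ℝ) d d' :=
  (Matrix.mem_rowStochastic_iff_sum.1 (ω x).2).1 d d'

lemma env_sum (ω : Env) (x : ℤ × ℤ) (d : Dir) : ∑ d', (ω x : Matrix Dir Dir ℝ) d d' = 1 :=
  (Matrix.mem_rowStochastic_iff_sum.1 (ω x).2).2 d

lemma stepMean_mono (ω : Env) {f g : State → ℝ} (h : ∀ z, f z ≤ g z) (z : State) :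
    stepMean ω f z ≤ stepMean ω g z :=
  Finset.sum_le_sum fun _ _ => mul_le_mul_of_nonneg_left (h _) (env_nonneg ω _ _ _)

lemma stepMean_const (ω : Env) (c : ℝ) (z : State) : stepMean ω (fun _ => c) z = c := by
  simp only [stepMean]
  rw [← Finset.sum_mul, env_sum, one_mul]

/-! ### Trajectory law and avoidance probabilities -/

lemma lintegral_stepKernel (ω : Env) {g : State → ℝ} (hg : ∀ z, 0 ≤ g z) (z : State) :
    ∫⁻ w, ENNReal.ofReal (g w) ∂stepKernel ω z = ENNReal.ofReal (stepMean ω g z) := by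
  change ∫⁻ w, ENNReal.ofReal (g w) ∂stepMeasure ω z = _
  rw [stepMeasure, lintegral_finsetSum_measure, stepMean, ENNReal.ofReal_sum_of_nonneg]
  · refine Finset.sum_congr rfl fun _ _ => ?_
    rw [lintegral_smul_measure, lintegral_dirac, smul_eq_mul,
      ENNReal.ofReal_mul (env_nonneg ω _ _ _)]
  · exact fun d' _ => mul_nonneg (env_nonneg ω _ _ _) (hg _)

instance (ω : Env) (ξ : State) : IsProbabilityMeasure (law ω ξ) := by
  unfold law; infer_instance

/-- The Markov property of the walk. -/
lemma lintegral_law_succ (ω : Env) (ξ : State) (n : ℕ)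
    {F : (∀ _ : Finset.Iic n, State) → ℝ≥0∞} (hF : Measurable F)
    {g : State → ℝ≥0∞} (hg : Measurable g) :
    ∫⁻ Z, F (Preorder.frestrictLe n Z) * g (Z (n + 1)) ∂law ω ξ =
      ∫⁻ Z, F (Preorder.frestrictLe n Z) * (∫⁻ w, g w ∂stepKernel ω (Z n)) ∂law ω ξ := by
  have hK : Measurable fun z => ∫⁻ w, g w ∂stepKernel ω z := hg.lintegral_kernel
  have hr : Measurable (Preorder.frestrictLe (π := fun _ : ℕ => State) n) :=
    Preorder.measurable_frestrictLe n
  have key : ∀ y : (∀ _ : Finset.Iic n, State),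
      ∫⁻ Z, F (Preorder.frestrictLe n Z) * g (Z (n + 1))
        ∂Kernel.traj (X := fun _ => State) (historyKernel ω) n y =
      F y * ∫⁻ w, g w ∂stepKernel ω (y ⟨n, Finset.mem_Iic.2 le_rfl⟩) := by
    intro y
    have h1 : ∀ Z : ℕ → State, Preorder.frestrictLe (π := fun _ : ℕ => State) n
        (Function.updateFinset Z (Finset.Iic n) y) = y := by
      intro Z; ext i : 1
      obtain ⟨i, hi⟩ := i
      simp only [Preorder.frestrictLe_apply, Function.updateFinset, hi, dite_true]
    have h2 : ∀ Z : ℕ → State,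
        Function.updateFinset Z (Finset.Iic n) y (n + 1) = Z (n + 1) := by
      intro Z
      simp [Function.updateFinset]
    rw [Kernel.lintegral_traj]
    · simp only [h1, h2]
      have he : Measurable fun Z : ℕ → State => Z (n + 1) := measurable_pi_apply _
      rw [lintegral_const_mul (F y) (f := fun Z : ℕ → State => g (Z (n + 1))) (hg.comp he)]
      congr 1
      rw [← lintegral_map (μ := Kernel.traj (X := fun _ => State) (historyKernel ω) n y)
        (f := g) (g := fun Z => Z (n + 1)) hg (measurable_pi_apply _),
        ← Kernel.map_apply _ (measurable_pi_apply _), Kernel.map_traj_succ_self]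
      rfl
    · exact (hF.comp hr).mul (hg.comp (measurable_pi_apply _))
  -- Split the law at time `n`: run the chain up to `n`, then continue from that history; `key`
  -- handles the continuation.
  have hlaw : law ω ξ = (Kernel.traj (X := fun _ => State) (historyKernel ω) n ∘ₖ
      Kernel.partialTraj (X := fun _ => State) (historyKernel ω) 0 n) (fun _ => ξ) := by
    rw [Kernel.traj_comp_partialTraj (Nat.zero_le n)]; rfl
  have hpart : Kernel.partialTraj (X := fun _ => State) (historyKernel ω) 0 n (fun _ => ξ) =
      (law ω ξ).map (Preorder.frestrictLe n) :=
    (Kernel.traj_map_frestrictLe_apply 0 n _).symm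
  conv_lhs => rw [hlaw]
  rw [Kernel.lintegral_comp]
  · simp only [key]
    rw [hpart, lintegral_map]
    · rfl
    · exact hF.mul (hK.comp (measurable_pi_apply _))
    · exact hr
  · exact (hF.comp hr).mul (hg.comp (measurable_pi_apply _))

lemma measurableSet_eq_coord {I : Type*} (i : I) (ξ : State) :
    MeasurableSet {y : I → State | y i = ξ} := by
  have h : Measurable fun y : I → State => y i := measurable_pi_apply i
  exact h (measurableSet_singleton ξ)

lemma law_zero (ω : Env) (ξ : State) : ∀ᵐ Z ∂law ω ξ, Z 0 = ξ := by
  have h : (law ω ξ).map (Preorder.frestrictLe 0) = Measure.dirac (fun _ => ξ) := by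
    have := Kernel.traj_map_frestrictLe_apply (X := fun _ => State) (κ := historyKernel ω) 0 0
      (fun _ => ξ)
    rw [Kernel.partialTraj_self, Kernel.id_apply] at this
    exact this
  have h0 : ∀ᵐ y ∂(law ω ξ).map (Preorder.frestrictLe 0),
      y ⟨0, Finset.mem_Iic.2 le_rfl⟩ = ξ := by
    rw [h]
    refine (ae_dirac_iff ?_).2 rfl
    exact measurableSet_eq_coord _ ξ
  exact ae_of_ae_map (Preorder.measurable_frestrictLe 0).aemeasurable h0

/-- The trajectories that avoid `ξ` at the times `1, …, n`. -/
def avoid (ξ : State) (n : ℕ) : Set (ℕ → State) := {Z | ∀ k, 0 < k → k ≤ n → Z k ≠ ξ}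

/-- The probability that the walk from `z` avoids `ξ` at the times `1, …, n`. -/
noncomputable def avoidProb (ω : Env) (ξ : State) : ℕ → State → ℝ
  | 0 => fun _ => 1
  | n + 1 => stepMean ω (({ξ}ᶜ : Set State).indicator (avoidProb ω ξ n))

lemma avoidProb_nonneg (ω : Env) (ξ : State) (n : ℕ) (z : State) : 0 ≤ avoidProb ω ξ n z := by
  induction n generalizing z with
  | zero => exact zero_le_one
  | succ n ih =>
    rw [avoidProb]
    exact Finset.sum_nonneg fun d' _ => mul_nonneg (env_nonneg ω _ _ _)
      (Set.indicator_nonneg (fun _ _ => ih _) _)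

lemma avoidProb_succ_le (ω : Env) (ξ : State) (n : ℕ) (z : State) :
    avoidProb ω ξ (n + 1) z ≤ avoidProb ω ξ n z := by
  induction n generalizing z with
  | zero =>
    refine (stepMean_mono ω (g := fun _ => 1) (fun w => ?_) z).trans_eq (stepMean_const ω 1 z)
    exact Set.indicator_le_self' (fun _ _ => zero_le_one) _
  | succ n ih => exact stepMean_mono ω (fun w => Set.indicator_le_indicator (ih w)) z

/-- Conditioning on the history up to time `n` trades the last step of the trajectory for one more
step of the recursion defining `avoidProb`. -/
lemma lintegral_avoid_succ (ω : Env) (ξ : State) (n m : ℕ) :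
    ∫⁻ Z, (avoid ξ (n + 1)).indicator 1 Z * ENNReal.ofReal (avoidProb ω ξ m (Z (n + 1))) ∂law ω ξ =
      ∫⁻ Z, (avoid ξ n).indicator 1 Z * ENNReal.ofReal (avoidProb ω ξ (m + 1) (Z n)) ∂law ω ξ := by
  classical
  set A : Set (∀ _ : Finset.Iic n, State) := {y | ∀ i : Finset.Iic n, 0 < i.1 → y i ≠ ξ}
  have hA : MeasurableSet A := by
    have : A = ⋂ i : Finset.Iic n, {y | 0 < i.1 → y i ≠ ξ} := by ext; simp [A]
    rw [this]
    refine MeasurableSet.iInter fun i => ?_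
    by_cases hi : 0 < i.1
    · simp only [hi, true_imp_iff]
      exact (measurableSet_eq_coord i ξ).compl
    · simp [hi]
  have hmem : ∀ Z : ℕ → State, Preorder.frestrictLe n Z ∈ A ↔ Z ∈ avoid ξ n := by
    intro Z
    constructor
    · intro h k hk hkn
      exact h ⟨k, Finset.mem_Iic.2 hkn⟩ hk
    · intro h i hi
      exact h i.1 hi (Finset.mem_Iic.1 i.2)
  have hF : ∀ Z : ℕ → State, (avoid ξ n).indicator (1 : (ℕ → State) → ℝ≥0∞) Z =
      A.indicator 1 (Preorder.frestrictLe n Z) := by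
    intro Z
    simp only [Set.indicator_apply, hmem, Pi.one_apply]
  have hsucc : ∀ Z : ℕ → State, (avoid ξ (n + 1)).indicator (1 : (ℕ → State) → ℝ≥0∞) Z *
      ENNReal.ofReal (avoidProb ω ξ m (Z (n + 1))) = (avoid ξ n).indicator 1 Z *
      ENNReal.ofReal (({ξ}ᶜ : Set State).indicator (avoidProb ω ξ m) (Z (n + 1))) := by
    intro Z
    have : Z ∈ avoid ξ (n + 1) ↔ Z ∈ avoid ξ n ∧ Z (n + 1) ≠ ξ := by
      constructor
      · exact fun h => ⟨fun k hk hkn => h k hk (by omega), h _ (by omega) le_rfl⟩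
      · rintro ⟨h, h'⟩ k hk hkn
        rcases Nat.le_succ_iff.1 hkn with hkn | rfl
        · exact h k hk hkn
        · exact h'
    by_cases h1 : Z ∈ avoid ξ n <;> by_cases h2 : Z (n + 1) = ξ <;>
      simp [this, h1, h2]
  simp only [hsucc, hF]
  rw [lintegral_law_succ ω ξ n (F := A.indicator 1)
    (g := fun w => ENNReal.ofReal (({ξ}ᶜ : Set State).indicator (avoidProb ω ξ m) w))
    (measurable_one.indicator hA) Measurable.of_discrete]
  refine lintegral_congr fun Z => ?_
  rw [lintegral_stepKernel ω
    (fun z => Set.indicator_nonneg (fun w _ => avoidProb_nonneg ω ξ m w) z)]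
  rfl

/-- Trading all `n` steps one at a time reduces the trajectory integral to time `0`, where the walk
sits at `ξ`. -/
lemma law_avoid (ω : Env) (ξ : State) (n : ℕ) :
    law ω ξ (avoid ξ n) = ENNReal.ofReal (avoidProb ω ξ n ξ) := by
  have hm : MeasurableSet (avoid ξ n) := by
    have : avoid ξ n = ⋂ k : ℕ, ⋂ _ : 0 < k, ⋂ _ : k ≤ n, {Z | Z k ≠ ξ} := by
      ext; simp [avoid]
    rw [this]
    exact MeasurableSet.iInter fun k => MeasurableSet.iInter fun _ => MeasurableSet.iInter fun _ =>
      (measurableSet_eq_coord k ξ).compl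
  have h : ∀ m k, ∫⁻ Z, (avoid ξ m).indicator 1 Z * ENNReal.ofReal (avoidProb ω ξ k (Z m)) ∂law ω ξ
      = ENNReal.ofReal (avoidProb ω ξ (m + k) ξ) := by
    intro m
    induction m with
    | zero =>
      intro k
      have : ∫⁻ Z, (avoid ξ 0).indicator 1 Z * ENNReal.ofReal (avoidProb ω ξ k (Z 0)) ∂law ω ξ =
          ∫⁻ _, ENNReal.ofReal (avoidProb ω ξ k ξ) ∂law ω ξ := by
        refine lintegral_congr_ae ((law_zero ω ξ).mono fun Z hZ => ?_)
        have : Z ∈ avoid ξ 0 := fun k hk hk0 => by omega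
        simp [this, hZ]
      rw [this, lintegral_const, measure_univ, mul_one, zero_add]
    | succ m ih =>
      intro k
      rw [lintegral_avoid_succ, ih, add_right_comm, add_assoc]
  have h0 := h n 0
  simp only [avoidProb, ENNReal.ofReal_one, mul_one] at h0
  rw [lintegral_indicator_one hm] at h0
  simpa using h0

/-- The walk is recurrent as soon as the avoidance probabilities tend to zero. -/
lemma recurrent_of_tendsto {ω : Env}
    (h : ∀ ξ, Filter.Tendsto (fun n => avoidProb ω ξ n ξ) Filter.atTop (nhds 0)) :
    Recurrent ω := by
  intro ξ
  have h0 : law ω ξ (⋂ n, avoid ξ n) = 0 := by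
    refine le_antisymm (ge_of_tendsto' (x := Filter.atTop)
      (f := fun n => ENNReal.ofReal (avoidProb ω ξ n ξ)) ?_ fun n => ?_) zero_le
    · simpa using ENNReal.tendsto_ofReal (h ξ)
    · rw [← law_avoid]
      exact measure_mono (Set.iInter_subset _ n)
  have h1 : ∀ᵐ Z ∂law ω ξ, Z ∉ ⋂ n, avoid ξ n := measure_eq_zero_iff_ae_notMem.1 h0
  have h2 : ∀ᵐ Z ∂law ω ξ, Z ∈ {Z : ℕ → State | ∃ k > 0, Z k = ξ ∧ ξ = Z 0} := by
    filter_upwards [h1, law_zero ω ξ] with Z hZ hZ0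
    simp only [Set.mem_iInter, avoid, Set.mem_ofPred_eq, not_forall, not_not] at hZ
    obtain ⟨n, k, hk, hkn, hZk⟩ := hZ
    exact ⟨k, hk, hZk, hZ0.symm⟩
  rw [measure_eq_measure_of_null_sdiff (Set.subset_univ _), measure_univ]
  rw [← Set.compl_eq_univ_sdiff]
  exact h2

/-! ### Maximum principle and Lyapunov criterion -/

/-- At a maximum point a submean function takes its maximum at all successors. -/
lemma closed_argmax {ω : Env} {f : State → ℝ} {M : ℝ} (hM : ∀ z, f z ≤ M)
    {z : State} (hz : M ≤ stepMean ω f z) {d' : Dir}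
    (hd : 0 < (ω z.1 : Matrix Dir Dir ℝ) z.2 d') : f (z.1 + d'.vec, d') = M := by
  by_contra hne
  have hlt : f (z.1 + d'.vec, d') < M := lt_of_le_of_ne (hM _) hne
  have : stepMean ω f z < stepMean ω (fun _ => M) z :=
    Finset.sum_lt_sum (fun d'' _ => mul_le_mul_of_nonneg_left (hM _) (env_nonneg ω _ _ _))
      ⟨d', Finset.mem_univ _, mul_lt_mul_of_pos_left hlt hd⟩
  rw [stepMean_const] at this
  exact absurd hz (not_le.2 this)

/-- A Lyapunov criterion for recurrence: an irreducible walk is recurrent if there is a function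
with finite sublevel sets which does not increase in the mean outside of a finite set. -/
theorem recurrent_of_lyapunov {ω : Env} (hω : Irreducible ω) {V : State → ℝ}
    (hV0 : ∀ z, 0 ≤ V z) (hV : ∀ c, {z | V z ≤ c}.Finite) {F : Set State} (hF : F.Finite)
    (hFne : F.Nonempty) (hVF : ∀ z ∉ F, stepMean ω V z ≤ V z) : Recurrent ω := by
  refine recurrent_of_tendsto fun ξ => ?_
  have hanti : ∀ z, Antitone fun n => avoidProb ω ξ n z := fun z =>
    antitone_nat_of_succ_le fun n => avoidProb_succ_le ω ξ n z
  have hbdd : ∀ z, BddBelow (Set.range fun n => avoidProb ω ξ n z) := fun z =>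
    ⟨0, by rintro _ ⟨n, rfl⟩; exact avoidProb_nonneg ω ξ n z⟩
  -- The probability of never visiting `ξ` at a positive time. It is bounded and submean; the aim is
  -- to show that it is constant, then zero.
  set v : State → ℝ := fun z => ⨅ n, avoidProb ω ξ n z with hv
  have hlim : ∀ z, Filter.Tendsto (fun n => avoidProb ω ξ n z) Filter.atTop (nhds (v z)) :=
    fun z => tendsto_atTop_ciInf (hanti z) (hbdd z)
  have hv0 : ∀ z, 0 ≤ v z := fun z => le_ciInf fun n => avoidProb_nonneg ω ξ n z
  have hv1 : ∀ z, v z ≤ 1 := fun z => ciInf_le (hbdd z) 0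
  have heq : ∀ z, v z = stepMean ω (({ξ}ᶜ : Set State).indicator v) z := by
    intro z
    refine tendsto_nhds_unique ((hlim z).comp (Filter.tendsto_add_atTop_nat 1)) ?_
    have hind : ∀ w, Filter.Tendsto (fun n => ({ξ}ᶜ : Set State).indicator (avoidProb ω ξ n) w)
        Filter.atTop (nhds (({ξ}ᶜ : Set State).indicator v w)) := by
      intro w
      by_cases h : w ∈ ({ξ}ᶜ : Set State)
      · simpa only [Set.indicator_of_mem h] using hlim w
      · simp only [Set.indicator_of_notMem h]
        exact tendsto_const_nhds
    exact tendsto_finsetSum _ fun d' _ => (hind (z.1 + d'.vec, d')).const_mul _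
  have hle : ∀ z, v z ≤ stepMean ω v z := fun z => (heq z).trans_le
    (stepMean_mono ω (fun w => Set.indicator_le_self' (fun _ _ => hv0 _) _) z)
  obtain ⟨z₀, hz₀, hmax⟩ := hF.exists_maximalFor v F hFne
  have hmax' : ∀ z ∈ F, v z ≤ v z₀ := fun z hz => by
    rcases le_total (v z) (v z₀) with h | h
    · exact h
    · exact hmax hz h
  -- If `v` exceeded its maximum over `F` somewhere, `u = v - v z₀ - ε V` would be positive there
  -- for small `ε`. Since `v ≤ 1`, positivity of `u` forces `V ≤ 1 / ε`, so `u` attains a positive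
  -- maximum. It does so off `F`, where `u` is submean, so by irreducibility `u` is constant,
  -- contradicting `u z₀ ≤ 0`.
  have hglob : ∀ z, v z ≤ v z₀ := by
    intro z
    by_contra! hz
    obtain ⟨ε, hε, hεz⟩ : ∃ ε > 0, 0 < v z - v z₀ - ε * V z := by
      refine ⟨(v z - v z₀) / (2 * (V z + 1)), by have := hV0 z; have := sub_pos.2 hz; positivity, ?_⟩
      have h1 := hV0 z
      have h2 := sub_pos.2 hz
      have : (v z - v z₀) / (2 * (V z + 1)) * V z ≤ (v z - v z₀) / 2 := by
        rw [div_mul_eq_mul_div, div_le_div_iff₀ (by positivity) (by positivity)]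
        nlinarith
      linarith
    set u : State → ℝ := fun z => v z - v z₀ - ε * V z with hu
    have hfin : {w | 0 < u w}.Finite := by
      refine (hV (1 / ε)).subset fun w (hw : 0 < v w - v z₀ - ε * V w) => ?_
      rw [Set.mem_ofPred_eq, le_div_iff₀ hε]
      linarith [hv1 w, hv0 z₀]
    obtain ⟨z₁, hz₁, hmax₁⟩ := hfin.exists_maximalFor u _ ⟨z, hεz⟩
    have hu₁ : ∀ w, u w ≤ u z₁ := by
      intro w
      rcases le_total (u w) (u z₁) with h | h
      · exact h
      · exact hmax₁ (show 0 < u w from lt_of_lt_of_le hz₁ h) h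
    have huniv : {w | u w = u z₁} = Set.univ := by
      refine hω _ ⟨z₁, rfl⟩ fun w hw d' hd' => closed_argmax hu₁ ?_ hd'
      have hwF : w ∉ F := fun hwF => by
        have h1 : 0 < u w := by rw [show u w = u z₁ from hw]; exact hz₁
        have h2 := mul_nonneg hε.le (hV0 w)
        have h3 := hmax' w hwF
        simp only [hu] at h1
        linarith
      have h3 : stepMean ω u w = stepMean ω v w - v z₀ - ε * stepMean ω V w := by
        conv_rhs => rw [← stepMean_const ω (v z₀) w]
        simp only [stepMean, hu, Finset.mul_sum, ← Finset.sum_sub_distrib]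
        refine Finset.sum_congr rfl fun d' _ => ?_
        ring
      rw [h3, ← show u w = u z₁ from hw]
      have h4 := mul_le_mul_of_nonneg_left (hVF w hwF) hε.le
      have h5 := hle w
      simp only [hu]
      linarith
    have h1 : u z₀ = u z₁ := by
      have : z₀ ∈ {w | u w = u z₁} := huniv ▸ Set.mem_univ _
      exact this
    have h2 : 0 < u z₀ := h1 ▸ hz₁
    have h3 := mul_nonneg hε.le (hV0 z₀)
    simp only [hu] at h2
    linarith
  have hconst : {w | v w = v z₀} = Set.univ :=
    hω _ ⟨z₀, rfl⟩ fun w hw d' hd' => closed_argmax hglob (hw.symm.le.trans (hle w)) hd'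
  have hvc : ∀ w, v w = v z₀ := fun w => by
    have : w ∈ {w | v w = v z₀} := hconst ▸ Set.mem_univ _
    exact this
  -- A positive constant `v` would satisfy `heq` only if no state could step to `ξ`; the complement
  -- of `ξ` would then be closed, against irreducibility.
  have hz : v z₀ = 0 := by
    by_contra hne
    have hpos : 0 < v z₀ := lt_of_le_of_ne (hv0 _) (Ne.symm hne)
    have : ({ξ}ᶜ : Set State) = Set.univ := by
      refine hω _ ⟨((ξ.1 + (1, 0), ξ.2) : State), fun h => ?_⟩ fun w _ d' hd' hmem => ?_
      · have := congrArg (fun z : State => z.1.1) h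
        simp at this
      · have h1 : ({ξ}ᶜ : Set State).indicator v (w.1 + d'.vec, d') = v z₀ :=
          closed_argmax (fun y => (Set.indicator_le_self' (fun _ _ => hv0 _) y).trans (hglob y))
            ((hvc w).symm.le.trans (heq w).le) hd'
        rw [Set.indicator_of_notMem (by simpa using hmem)] at h1
        exact hne h1.symm
    exact absurd (this ▸ Set.mem_univ ξ) (fun h : ξ ∈ ({ξ}ᶜ : Set State) => h rfl)
  have := hlim ξ
  rwa [hvc ξ, hz] at this

/-! ### Irreducibility -/

/-- If diagonal steps upwards are always possible, and diagonal steps downwards are possible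
outside of a box, then every even site leads to every other one. -/
lemma even_reach {G : ℤ → ℤ → Prop} {N : ℤ}
    (hup : ∀ a b, Even (a + b) → G a b → G (a + 1) (b + 1) ∧ G (a - 1) (b + 1))
    (hdown : ∀ a b, Even (a + b) → N ≤ |a| ∨ N ≤ |b| → G a b →
      G (a + 1) (b - 1) ∧ G (a - 1) (b - 1))
    {a b c d : ℤ} (hab : Even (a + b)) (hcd : Even (c + d)) (h : G a b) : G c d := by
  have up : ∀ (k : ℕ) (a b : ℤ), Even (a + b) → G a b → G a (b + 2 * k) := by
    intro k
    induction k with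
    | zero => intro a b _ h; simpa using h
    | succ k ih =>
      intro a b he h
      have h1 := (hup a b he h).1
      have h2 := (hup _ _ (by grind) h1).2
      have h3 := ih _ _ (by grind) h2
      convert h3 using 1 <;> push_cast <;> ring
  have right : ∀ (k : ℕ) (a b : ℤ), Even (a + b) → N ≤ b → G a b → G (a + 2 * k) b := by
    intro k
    induction k with
    | zero => intro a b _ _ h; simpa using h
    | succ k ih =>
      intro a b he hb h
      have h1 := (hup a b he h).1
      have h2 := (hdown _ _ (by grind) (Or.inr ((by omega : N ≤ b + 1).trans (le_abs_self _))) h1).1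
      have h3 := ih _ _ (by grind) (by omega) h2
      convert h3 using 1 <;> push_cast <;> ring
  have down : ∀ (k : ℕ) (a b : ℤ), Even (a + b) → N + 1 ≤ a → G a b → G a (b - 2 * k) := by
    intro k
    induction k with
    | zero => intro a b _ _ h; simpa using h
    | succ k ih =>
      intro a b he ha h
      have h1 := (hdown a b he (Or.inl ((by omega : N ≤ a).trans (le_abs_self _))) h).2
      have h2 := (hdown _ _ (by grind) (Or.inl ((by omega : N ≤ a - 1).trans (le_abs_self _))) h1).1
      have h3 := ih _ _ (by grind) (by omega) h2
      convert h3 using 1 <;> push_cast <;> ring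
  have left : ∀ (k : ℕ) (a b : ℤ), Even (a + b) → b ≤ -N → G a b → G (a - 2 * k) b := by
    intro k
    induction k with
    | zero => intro a b _ _ h; simpa using h
    | succ k ih =>
      intro a b he hb h
      have h1 := (hdown a b he (Or.inr ((by omega : N ≤ -b).trans (neg_le_abs _))) h).2
      have h2 := (hup _ _ (by grind) h1).2
      have h3 := ih _ _ (by grind) (by omega) h2
      convert h3 using 1 <;> push_cast <;> ring
  -- Circle the box: up above it, right past it, down below it, left to the column of the target,
  -- and up to the target. The last leg may cross the box because upward steps are always possible.
  have main : ∀ a b, Even (a + b) → Even (c - a) → G a b → G c d := by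
    intro a b hab hac h
    obtain ⟨i, hi⟩ := hac
    obtain ⟨j, hj⟩ : Even (d - b) := by grind
    have h1 := up (N.natAbs + b.natAbs) a b hab h
    have h2 := right (N.natAbs + a.natAbs + 1 + i.natAbs) _ _ (by grind) (by omega) h1
    have h3 := down (N.natAbs + (N.natAbs + b.natAbs) + b.natAbs + j.natAbs) _ _ (by grind)
      (by omega) h2
    have h4 := left (N.natAbs + a.natAbs + 1 + i.natAbs - i).toNat _ _ (by grind) (by omega) h3
    have h5 := up (N.natAbs + b.natAbs + j.natAbs + j).toNat _ _ (by grind) h4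
    convert h5 using 1 <;> omega
  by_cases hac : Even (c - a)
  · exact main a b hab hac h
  · exact main (a + 1) (b + 1) (by grind) (by grind) (hup a b hab h).1

variable {ζ : ℤ × ℤ → unitInterval} {S : Set State}

lemma forwardProb_vertical_even {a b : ℤ} (h : Even (a + b)) :
    forwardProb ζ (a, b) Dir.n = ζ (a, b) ∧ forwardProb ζ (a, b) Dir.s = 0 := by
  simp [forwardProb, evenSites, oddSites, h]

lemma forwardProb_vertical_odd {a b : ℤ} (h : ¬ Even (a + b)) :
    forwardProb ζ (a, b) Dir.s = ζ (a, b) ∧ forwardProb ζ (a, b) Dir.n = 0 := by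
  simp [forwardProb, evenSites, oddSites, h]

lemma forwardProb_horizontal (x : ℤ × ℤ) :
    forwardProb ζ x Dir.e = 0 ∧ forwardProb ζ x Dir.w = 0 := by
  simp [forwardProb]

lemma Closed.left_mem (hS : Closed (forwardEnv ζ) S) {x : ℤ × ℤ} {d : Dir} (h : (x, d) ∈ S)
    (hp : forwardProb ζ x d < 1) : (x + d.left.vec, d.left) ∈ S := by
  refine hS _ h _ ?_
  change 0 < turn (forwardProb ζ x d) d d.left
  cases d <;> simpa [turn, Dir.left, Dir.forward] using hp

lemma Closed.right_mem (hS : Closed (forwardEnv ζ) S) {x : ℤ × ℤ} {d : Dir} (h : (x, d) ∈ S)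
    (hp : forwardProb ζ x d < 1) : (x + d.right.vec, d.right) ∈ S := by
  refine hS _ h _ ?_
  change 0 < turn (forwardProb ζ x d) d d.right
  cases d <;> simpa [turn, Dir.left, Dir.right, Dir.forward] using hp

lemma Closed.forward_mem (hS : Closed (forwardEnv ζ) S) {x : ℤ × ℤ} {d : Dir} (h : (x, d) ∈ S)
    (hp : 0 < forwardProb ζ x d) : (x + d.vec, d) ∈ S := by
  refine hS _ h _ ?_
  change 0 < turn (forwardProb ζ x d) d d
  have : 0 < (forwardProb ζ x d : ℝ) := hp
  simpa [turn, Dir.forward] using this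

/-- The set `S` contains a state with horizontal direction at the site `(a, b)`. -/
def Horizontal (S : Set State) (a b : ℤ) : Prop := ((a, b), Dir.e) ∈ S ∨ ((a, b), Dir.w) ∈ S

lemma Closed.north_mem (hS : Closed (forwardEnv ζ) S) {a b : ℤ} (h : Horizontal S a b) :
    ((a, b + 1), Dir.n) ∈ S := by
  rcases h with h | h
  · simpa [Dir.left, Dir.vec] using hS.left_mem h (by simp [forwardProb_horizontal])
  · simpa [Dir.right, Dir.vec] using hS.right_mem h (by simp [forwardProb_horizontal])

lemma Closed.south_mem (hS : Closed (forwardEnv ζ) S) {a b : ℤ} (h : Horizontal S a b) :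
    ((a, b - 1), Dir.s) ∈ S := by
  rcases h with h | h
  · simpa [Dir.right, Dir.vec] using! hS.right_mem h (by simp [forwardProb_horizontal])
  · simpa [Dir.left, Dir.vec] using! hS.left_mem h (by simp [forwardProb_horizontal])

lemma Closed.turn_north (hS : Closed (forwardEnv ζ) S) {a b : ℤ} (h : ((a, b), Dir.n) ∈ S)
    (hp : ¬ Even (a + b) ∨ ζ (a, b) < 1) :
    ((a + 1, b), Dir.e) ∈ S ∧ ((a - 1, b), Dir.w) ∈ S := by
  have hlt : forwardProb ζ (a, b) Dir.n < 1 := by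
    by_cases he : Even (a + b)
    · rw [(forwardProb_vertical_even he).1]; exact hp.resolve_left (not_not.2 he)
    · rw [(forwardProb_vertical_odd he).2]; exact zero_lt_one
  exact ⟨by simpa [Dir.right, Dir.vec] using! hS.right_mem h hlt,
    by simpa [Dir.left, Dir.vec] using! hS.left_mem h hlt⟩

lemma Closed.turn_south (hS : Closed (forwardEnv ζ) S) {a b : ℤ} (h : ((a, b), Dir.s) ∈ S)
    (hp : Even (a + b) ∨ ζ (a, b) < 1) :
    ((a + 1, b), Dir.e) ∈ S ∧ ((a - 1, b), Dir.w) ∈ S := by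
  have hlt : forwardProb ζ (a, b) Dir.s < 1 := by
    by_cases he : Even (a + b)
    · rw [(forwardProb_vertical_even he).2]; exact zero_lt_one
    · rw [(forwardProb_vertical_odd he).1]; exact hp.resolve_left he
  exact ⟨by simpa [Dir.left, Dir.vec] using! hS.left_mem h hlt,
    by simpa [Dir.right, Dir.vec] using! hS.right_mem h hlt⟩

lemma Closed.forward_north (hS : Closed (forwardEnv ζ) S) {a b : ℤ} (h : ((a, b), Dir.n) ∈ S)
    (he : Even (a + b)) (hp : 0 < ζ (a, b)) : ((a, b + 1), Dir.n) ∈ S := by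
  rw [← (forwardProb_vertical_even (ζ := ζ) he).1] at hp
  simpa [Dir.vec] using hS.forward_mem h hp

lemma Closed.forward_south (hS : Closed (forwardEnv ζ) S) {a b : ℤ} (h : ((a, b), Dir.s) ∈ S)
    (he : ¬ Even (a + b)) (hp : 0 < ζ (a, b)) : ((a, b - 1), Dir.s) ∈ S := by
  rw [← (forwardProb_vertical_odd (ζ := ζ) he).1] at hp
  simpa [Dir.vec] using! hS.forward_mem h hp

/-- Even where `ζ = 1` forces a forward step, the next site has the other parity and there the walk
must turn. -/
lemma Closed.exists_horizontal (hS : Closed (forwardEnv ζ) S) (hne : S.Nonempty) :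
    ∃ a b, Horizontal S a b := by
  obtain ⟨⟨⟨a, b⟩, d⟩, h⟩ := hne
  cases d with
  | e => exact ⟨a, b, Or.inl h⟩
  | w => exact ⟨a, b, Or.inr h⟩
  | n =>
    by_cases hp : ¬ Even (a + b) ∨ ζ (a, b) < 1
    · exact ⟨_, _, Or.inl (hS.turn_north h hp).1⟩
    · push Not at hp
      exact ⟨_, _, Or.inl (hS.turn_north
        (hS.forward_north h hp.1 (zero_lt_one.trans_le hp.2)) (Or.inl (by grind))).1⟩
  | s =>
    by_cases hp : Even (a + b) ∨ ζ (a, b) < 1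
    · exact ⟨_, _, Or.inl (hS.turn_south h hp).1⟩
    · push Not at hp
      exact ⟨_, _, Or.inl (hS.turn_south
        (hS.forward_south h (by grind) (zero_lt_one.trans_le hp.2)) (Or.inl (by grind))).1⟩

theorem irreducible_forwardEnv (hfin : {x : ℤ × ℤ | ζ x = 1}.Finite)
    (heven : ∃ x ∈ evenSites, 0 < ζ x) (hodd : ∃ y ∈ oddSites, 0 < ζ y) :
    Irreducible (forwardEnv ζ) := by
  intro S hne hS
  -- The slack of 2 allows for the turn taking place at `b - 1` in the even class and, in reflected
  -- coordinates, at `1 - b + 1 = 2 - b` in the odd class.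
  obtain ⟨N, hN⟩ : ∃ N : ℤ, ∀ a b : ℤ, N ≤ |a| + 2 ∨ N ≤ |b| + 2 → ζ (a, b) < 1 := by
    obtain ⟨N, hN⟩ := (hfin.image fun x : ℤ × ℤ => |x.1| + |x.2|).bddAbove
    refine ⟨N + 3, fun a b h => lt_of_le_of_ne unitInterval.le_one' fun h1 => ?_⟩
    have := hN ⟨(a, b), h1, rfl⟩
    have h2 := abs_nonneg a
    have h3 := abs_nonneg b
    simp only at this
    omega
  have hbox : ∀ a b : ℤ, N ≤ |a| ∨ N ≤ |b| → (N ≤ |a| + 2 ∨ N ≤ |b - 1| + 2) ∧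
      (N ≤ |a| + 2 ∨ N ≤ |1 - b + 1| + 2) := by
    intro a b h
    have h1 := abs_sub_abs_le_abs_sub b 1
    have h2 := abs_sub_abs_le_abs_sub b 2
    rw [show 1 - b + 1 = -(b - 2) by ring, abs_neg]
    norm_num at h1 h2
    omega
  have reach_even : ∀ {a b c d : ℤ}, Even (a + b) → Even (c + d) → Horizontal S a b →
      Horizontal S c d := by
    intro a b c d
    refine even_reach (G := Horizontal S) (N := N) (fun a b he h => ?_) (fun a b he hab h => ?_)
    · have := hS.turn_north (hS.north_mem h) (Or.inl (by grind))
      exact ⟨Or.inl this.1, Or.inr this.2⟩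
    · have := hS.turn_south (hS.south_mem h) (Or.inr (hN _ _ (hbox _ _ hab).1))
      exact ⟨Or.inl this.1, Or.inr this.2⟩
  have reach_odd : ∀ {a b c d : ℤ}, ¬ Even (a + b) → ¬ Even (c + d) → Horizontal S a b →
      Horizontal S c d := by
    intro a b c d hab hcd h
    -- The reflection `b ↦ 1 - b` exchanges the parities and up with down: in the odd class it is
    -- the downward steps that are always possible.
    have := even_reach (G := fun a b => Horizontal S a (1 - b)) (N := N)
      (a := a) (b := 1 - b) (c := c) (d := 1 - d)
      (fun a b he h => ?_) (fun a b he hab h => ?_) (by grind) (by grind) (by simpa using h)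
    · simpa using this
    · have := hS.turn_south (hS.south_mem h) (Or.inl (by grind))
      rw [show 1 - (b + 1) = 1 - b - 1 by ring]
      exact ⟨Or.inl this.1, Or.inr this.2⟩
    · have := hS.turn_north (hS.north_mem h) (Or.inr (hN _ _ (hbox _ _ hab).2))
      rw [show 1 - (b - 1) = 1 - b + 1 by ring]
      exact ⟨Or.inl this.1, Or.inr this.2⟩
  obtain ⟨⟨p, q⟩, hpq, hζ⟩ := heven
  obtain ⟨⟨p', q'⟩, hpq', hζ'⟩ := hodd
  replace hpq : Even (p + q) := hpq
  replace hpq' : ¬ Even (p' + q') := hpq'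
  -- A forward step south at the odd site `(p', q')` makes the vertical displacement 2 instead of 1,
  -- which changes the parity class.
  have odd_of_even : Horizontal S p' (q' + 1) → Horizontal S (p' + 1) (q' - 1) := fun h => by
    have h1 := hS.south_mem h
    rw [add_sub_cancel_right] at h1
    exact Or.inl (hS.turn_south (hS.forward_south h1 hpq' hζ') (Or.inl (by grind))).1
  have even_of_odd : Horizontal S p (q - 1) → Horizontal S (p + 1) (q + 1) := fun h => by
    have h1 := hS.north_mem h
    rw [sub_add_cancel] at h1
    exact Or.inl (hS.turn_north (hS.forward_north h1 hpq hζ) (Or.inl (by grind))).1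
  have all : ∀ c d, Horizontal S c d := by
    obtain ⟨a, b, h⟩ := hS.exists_horizontal hne
    intro c d
    by_cases hab : Even (a + b) <;> by_cases hcd : Even (c + d)
    · exact reach_even hab hcd h
    · exact reach_odd (by grind) hcd (odd_of_even (reach_even hab (by grind) h))
    · exact reach_even (by grind) hcd (even_of_odd (reach_odd hab (by grind) h))
    · exact reach_odd hab hcd h
  refine Set.eq_univ_of_forall ?_
  rintro ⟨⟨a, b⟩, d⟩
  have hn : ∀ a b, ((a, b), Dir.n) ∈ S := fun a b => by simpa using hS.north_mem (all a (b - 1))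
  have hs : ∀ a b, ((a, b), Dir.s) ∈ S := fun a b => by simpa using hS.south_mem (all a (b + 1))
  cases d with
  | n => exact hn a b
  | s => exact hs a b
  | e =>
    by_cases he : Even (a + b)
    · simpa using (hS.turn_north (hn (a - 1) b) (Or.inl (by grind))).1
    · simpa using (hS.turn_south (hs (a - 1) b) (Or.inl (by grind))).1
  | w =>
    by_cases he : Even (a + b)
    · simpa using (hS.turn_north (hn (a + 1) b) (Or.inl (by grind))).2
    · simpa using (hS.turn_south (hs (a + 1) b) (Or.inl (by grind))).2

/-! ### Logarithmic potential and Lyapunov function -/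

/-- A function on the plane, superharmonic far from the origin for the diagonal random walk. -/
noncomputable def logPotential (a b : ℤ) : ℝ := Real.log ((a ^ 2 + b ^ 2 - 2 : ℤ) : ℝ)

lemma logPotential_nonneg (a b : ℤ) : 0 ≤ logPotential a b := Real.log_intCast_nonneg _

lemma le_of_logPotential_le {a b : ℤ} {c : ℝ} (h : logPotential a b ≤ c) :
    ((a ^ 2 + b ^ 2 : ℤ) : ℝ) ≤ Real.exp c + 2 := by
  have h2 : ((a ^ 2 + b ^ 2 - 2 : ℤ) : ℝ) ≤ Real.exp c := by
    rcases le_or_gt ((a ^ 2 + b ^ 2 - 2 : ℤ) : ℝ) 0 with h0 | h0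
    · exact h0.trans (Real.exp_pos _).le
    · exact (Real.log_le_iff_le_exp h0).1 h
  push_cast at h2 ⊢
  linarith

/-- After exponentiation this is a polynomial inequality between the product of the four
neighbouring values and the fourth power of the central one. The shift by `-2` matters: for the
plain `log (a ^ 2 + b ^ 2)` the inequality fails on the axes. -/
lemma logPotential_superharmonic {a b : ℤ} (h : 10 ≤ a ^ 2 + b ^ 2) :
    logPotential (a + 1) (b + 1) + logPotential (a - 1) (b + 1) + logPotential (a + 1) (b - 1) +
      logPotential (a - 1) (b - 1) ≤ 4 * logPotential a b := by
  have hS : 0 < a ^ 2 + b ^ 2 - 2 := by omega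
  have pos : ∀ i j : ℤ, i ^ 2 = 1 → j ^ 2 = 1 → 0 < (a + i) ^ 2 + (b + j) ^ 2 - 2 := by
    intro i j hi hj
    -- The shifted square norm at a neighbour is `r² + 2 (i a + j b)` with `r² = a² + b²`; it is
    -- positive since `8 r² < r⁴`.
    have h1 : (2 * (i * a + j * b)) ^ 2 ≤ 8 * (a ^ 2 + b ^ 2) := by
      nlinarith [sq_nonneg (i * a - j * b), mul_pow i a 2, mul_pow j b 2]
    have h2 : -(a ^ 2 + b ^ 2) < 2 * (i * a + j * b) :=
      (abs_lt.1 (abs_lt_of_sq_lt_sq (by nlinarith) (by omega))).1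
    nlinarith
  have h1 := pos 1 1 (by norm_num) (by norm_num)
  have h2 := pos (-1) 1 (by norm_num) (by norm_num)
  have h3 := pos 1 (-1) (by norm_num) (by norm_num)
  have h4 := pos (-1) (-1) (by norm_num) (by norm_num)
  simp only [← sub_eq_add_neg] at h2 h3 h4
  have key : ((a + 1) ^ 2 + (b + 1) ^ 2 - 2) * ((a - 1) ^ 2 + (b + 1) ^ 2 - 2) *
      ((a + 1) ^ 2 + (b - 1) ^ 2 - 2) * ((a - 1) ^ 2 + (b - 1) ^ 2 - 2) ≤
      (a ^ 2 + b ^ 2 - 2) ^ 4 := by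
    have h5 : 16 ≤ (a ^ 2 + b ^ 2 - 2) ^ 2 := by nlinarith
    have h6 : 0 ≤ (a * b) ^ 2 := sq_nonneg _
    have : (a ^ 2 + b ^ 2 - 2) ^ 4 - ((a + 1) ^ 2 + (b + 1) ^ 2 - 2) *
        ((a - 1) ^ 2 + (b + 1) ^ 2 - 2) *
        ((a + 1) ^ 2 + (b - 1) ^ 2 - 2) * ((a - 1) ^ 2 + (b - 1) ^ 2 - 2) =
        8 * (a ^ 2 + b ^ 2 - 2) ^ 2 - 16 + 64 * (a * b) ^ 2 := by ring
    linarith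
  have key' : ((((a + 1) ^ 2 + (b + 1) ^ 2 - 2 : ℤ) : ℝ) *
      (((a - 1) ^ 2 + (b + 1) ^ 2 - 2 : ℤ) : ℝ) *
      (((a + 1) ^ 2 + (b - 1) ^ 2 - 2 : ℤ) : ℝ) * (((a - 1) ^ 2 + (b - 1) ^ 2 - 2 : ℤ) : ℝ)) ≤
      ((a ^ 2 + b ^ 2 - 2 : ℤ) : ℝ) ^ 4 := by exact_mod_cast key
  have r1 : (0 : ℝ) < (((a + 1) ^ 2 + (b + 1) ^ 2 - 2 : ℤ) : ℝ) := Int.cast_pos.2 h1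
  have r2 : (0 : ℝ) < (((a - 1) ^ 2 + (b + 1) ^ 2 - 2 : ℤ) : ℝ) := Int.cast_pos.2 h2
  have r3 : (0 : ℝ) < (((a + 1) ^ 2 + (b - 1) ^ 2 - 2 : ℤ) : ℝ) := Int.cast_pos.2 h3
  have r4 : (0 : ℝ) < (((a - 1) ^ 2 + (b - 1) ^ 2 - 2 : ℤ) : ℝ) := Int.cast_pos.2 h4
  have hlog := Real.log_le_log (by positivity) key'
  rw [Real.log_mul (by positivity) r4.ne', Real.log_mul (by positivity) r3.ne',
    Real.log_mul r1.ne' r2.ne', Real.log_pow] at hlog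
  exact_mod_cast hlog

/-- The Lyapunov function of the walk. The second coordinate is raised by one at the odd sites for
a horizontal direction and at the even sites for a vertical one: with this correction the walk,
observed when its direction is horizontal, is the simple diagonal random walk. -/
noncomputable def lyapunov : State → ℝ
  | ((a, b), Dir.e) => logPotential a (if Even (a + b) then b else b + 1)
  | ((a, b), Dir.w) => logPotential a (if Even (a + b) then b else b + 1)
  | ((a, b), Dir.n) => (logPotential (a + 1) (if Even (a + b) then b + 1 else b) +
      logPotential (a - 1) (if Even (a + b) then b + 1 else b)) / 2
  | ((a, b), Dir.s) => (logPotential (a + 1) (if Even (a + b) then b + 1 else b) +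
      logPotential (a - 1) (if Even (a + b) then b + 1 else b)) / 2

lemma lyapunov_nonneg (z : State) : 0 ≤ lyapunov z := by
  obtain ⟨⟨a, b⟩, d⟩ := z
  cases d
  · exact logPotential_nonneg _ _
  · exact div_nonneg (add_nonneg (logPotential_nonneg _ _) (logPotential_nonneg _ _)) zero_le_two
  · exact logPotential_nonneg _ _
  · exact div_nonneg (add_nonneg (logPotential_nonneg _ _) (logPotential_nonneg _ _)) zero_le_two

lemma finite_box (N : ℤ) : {z : State | |z.1.1| ≤ N ∧ |z.1.2| ≤ N}.Finite := by
  refine (((Set.finite_Icc (-N) N).prod (Set.finite_Icc (-N) N)).prod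
    (Set.finite_univ (α := Dir))).subset ?_
  rintro ⟨⟨a, b⟩, d⟩ ⟨ha, hb⟩
  exact ⟨⟨abs_le.1 ha, abs_le.1 hb⟩, Set.mem_univ _⟩

lemma finite_lyapunov_le (c : ℝ) : {z | lyapunov z ≤ c}.Finite := by
  obtain ⟨N, hN⟩ := exists_int_gt (max (Real.exp c) (Real.exp (2 * c)) + 2)
  have hN1 : Real.exp c + 2 ≤ N := by linarith [le_max_left (Real.exp c) (Real.exp (2 * c))]
  have hN2 : Real.exp (2 * c) + 2 ≤ N := by linarith [le_max_right (Real.exp c) (Real.exp (2 * c))]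
  have bound : ∀ a b : ℤ, a ^ 2 + b ^ 2 ≤ N → |a| ≤ N ∧ |b| ≤ N := by
    intro a b h
    have ha := (Int.le_self_sq |a|).trans_eq (sq_abs a)
    have hb := (Int.le_self_sq |b|).trans_eq (sq_abs b)
    constructor <;> nlinarith [sq_nonneg a, sq_nonneg b]
  have hor : ∀ a b : ℤ, logPotential a b ≤ c → |a| ≤ N ∧ |b| ≤ N := fun a b h =>
    bound a b (by exact_mod_cast (le_of_logPotential_le h).trans hN1)
  -- Both logarithms are nonnegative, so bounding their mean by `c` bounds one of them by `2 * c`.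
  have ver : ∀ a b : ℤ, (logPotential (a + 1) b + logPotential (a - 1) b) / 2 ≤ c →
      |a + 1| ≤ N ∧ |b| ≤ N := fun a b h =>
    bound _ b (by
      exact_mod_cast (le_of_logPotential_le (c := 2 * c)
        (by linarith [logPotential_nonneg (a - 1) b])).trans hN2)
  refine (finite_box (N + 1)).subset ?_
  rintro ⟨⟨a, b⟩, d⟩ (hz : lyapunov ((a, b), d) ≤ c)
  change |a| ≤ N + 1 ∧ |b| ≤ N + 1
  cases d
  · have := hor _ _ hz
    split_ifs at this <;> grind
  · have := ver _ _ hz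
    split_ifs at this <;> grind
  · have := hor _ _ hz
    split_ifs at this <;> grind
  · have := ver _ _ hz
    split_ifs at this <;> grind

lemma stepMean_forwardEnv (ζ : ℤ × ℤ → unitInterval) (g : State → ℝ) (a b : ℤ) (d : Dir) :
    stepMean (forwardEnv ζ) g ((a, b), d) =
      turn (forwardProb ζ (a, b) d) d Dir.e * g ((a + 1, b), Dir.e) +
      turn (forwardProb ζ (a, b) d) d Dir.n * g ((a, b + 1), Dir.n) +
      turn (forwardProb ζ (a, b) d) d Dir.w * g ((a - 1, b), Dir.w) +
      turn (forwardProb ζ (a, b) d) d Dir.s * g ((a, b - 1), Dir.s) := by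
  have hu : (Finset.univ : Finset Dir) = {Dir.e, Dir.n, Dir.w, Dir.s} := rfl
  rw [stepMean, hu]
  rw [Finset.sum_insert (by decide), Finset.sum_insert (by decide), Finset.sum_insert (by decide),
    Finset.sum_singleton]
  simp only [Dir.vec, Prod.mk_add_mk, add_zero, ← sub_eq_add_neg, add_assoc]
  rfl

/-- Equality holds for vertical directions: the value there is the mean over the two turns, and a
forward step preserves it. For horizontal directions the inequality is superharmonicity at the
corrected height, `b` or `b + 1`. -/
lemma stepMean_lyapunov_le (ζ : ℤ × ℤ → unitInterval) {z : State}
    (hz : z ∉ {z : State | |z.1.1| ≤ 5 ∧ |z.1.2| ≤ 5}) :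
    stepMean (forwardEnv ζ) lyapunov z ≤ lyapunov z := by
  obtain ⟨⟨a, b⟩, d⟩ := z
  have far : ∀ c, c = b ∨ c = b + 1 → 10 ≤ a ^ 2 + c ^ 2 := by
    intro c hc
    have h1 : 4 ≤ |a| ∨ 4 ≤ |c| := by
      by_contra! h
      refine hz ⟨?_, ?_⟩ <;> simp only <;> grind
    rcases h1 with h1 | h1
    · nlinarith [sq_abs a, sq_nonneg c]
    · nlinarith [sq_abs c, sq_nonneg a]
  have hsup := logPotential_superharmonic (far b (Or.inl rfl))
  have hsup' := logPotential_superharmonic (far (b + 1) (Or.inr rfl))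
  have e1 : Even (a + 1 + b) ↔ ¬ Even (a + b) := by grind
  have e2 : Even (a - 1 + b) ↔ ¬ Even (a + b) := by grind
  have e3 : Even (a + (b + 1)) ↔ ¬ Even (a + b) := by grind
  have e4 : Even (a + (b - 1)) ↔ ¬ Even (a + b) := by grind
  rw [stepMean_forwardEnv]
  by_cases he : Even (a + b)
  · cases d <;> simp only [lyapunov, e1, e2, e3, e4, he, turn, Dir.forward, Dir.left, Dir.right,
      forwardProb_vertical_even he, forwardProb_horizontal, reduceCtorEq, not_true, if_true,
      if_false, or_true, or_false, Set.Icc.coe_zero] <;> linarith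
  · rw [add_sub_cancel_right] at hsup'
    cases d <;> simp only [lyapunov, e1, e2, e3, e4, he, turn, Dir.forward, Dir.left, Dir.right,
      forwardProb_vertical_odd he, forwardProb_horizontal, reduceCtorEq, not_false_iff, if_true,
      if_false, or_true, or_false, Set.Icc.coe_zero, sub_add_cancel] <;> linarith

end PRW

theorem mainTheorem4 (ζ : ℤ × ℤ → unitInterval)
    (hfin : {x : ℤ × ℤ | ζ x = 1}.Finite)
    (heven : ∃ x ∈ PRW.evenSites, 0 < ζ x)
    (hodd : ∃ y ∈ PRW.oddSites, 0 < ζ y) :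
    PRW.Recurrent (PRW.forwardEnv ζ) :=
  PRW.recurrent_of_lyapunov (PRW.irreducible_forwardEnv hfin heven hodd) PRW.lyapunov_nonneg
    PRW.finite_lyapunov_le (PRW.finite_box 5) ⟨((0, 0), PRW.Dir.e), by simp⟩
    fun _ => PRW.stepMean_lyapunov_le ζ
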